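/- **Theorem 3.1 (Lax–Milgram over $C^*$-algebras of compact operators).** Let $\mathscr A$ be a $C^*$-algebra of compact operators, i.e. a $C^*$-algebra admitting a faithful $*$-representation by compact operators on some Hilbert space, and let $\mathscr X$, $\mathscr Y$ be Hilbert $C^*$-modules over $\mathscr A$ (complete, with $\mathscr A$-valued inner product $\langle\cdot,\cdot\rangle$ that is $\mathscr A$-linear in the second variable, and norm $\|x\|=\|\langle x,x\rangle\|^{1/2}$). Write $|x|=\langle x,x\rangle^{1/2}\in\mathscr A$, and let $\mathcal{PS}(\mathscr A)$ be the set of pure states of $\mathscr A$. Let $B:\mathscr X\times\mathscr Y\to\mathscr A$ satisfy: (a) $B$ is a bounded $\mathscr A$-sesquilinear form, i.e. $\mathscr A$-linear in the second variable and anti-$\mathscr A$-linear in the first; (b) there exist $c>0$ and $k>0$ such that for any $f\in\mathcal{PS}(\mathscr A)$ and any $x\in\mathscr X$ there exists $y\in\mathscr Y$ with $\|y\|=1$, $f(|y|)\ge k$ and $|f(B(x,y))|\ge c\,f(|x|)\,f(|y|)$; (c) there exist $c>0$ and $k>0$ such that for any $f\in\mathcal{PS}(\mathscr A)$ and any $y\in\mathscr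 Y$ there exists $x\in\mathscr X$ with $\|x\|=1$, $f(|x|)\ge k$ and $|f(B(x,y))|\ge c\,f(|x|)\,f(|y|)$. Then there exists a bounded adjointable invertible $\mathscr A$-linear operator $T:\mathscr X\to\mathscr Y$ such that $B(x,y)=\langle T(x),y\rangle$ for all $x\in\mathscr X$, $y\in\mathscr Y$. This holds although the Riesz theorem can fail for such modules: there exist a $C^*$-algebra $\mathscr A$ of compact operators, a Hilbert $\mathscr A$-module $\mathscr X$, and a bounded $\mathscr A$-linear map $\tau:\mathscr X\to\mathscr A$ that is not of the form $y\mapsto\langle x,y\rangle$ with $x\in\mathscr X$. (Modules over $\mathscr A$ are taken here as left modules, with $\langle x,ay\rangle=a\langle x,y\rangle$, $B(x,ay)=aB(x,y)$ and $B(ax,y)=B(x,y)a^*$; the version for right modules is the same statement for the opposite algebra.) -/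

import Mathlib

open scoped ComplexOrder

universe u v w z

noncomputable section

namespace HilbertCStar

/-- `A` is a C⋆-algebra of compact operators: it has a faithful ⋆-representation by compact
operators on some Hilbert space `H`. The universe `z` of `H` is arbitrary. -/
def IsCompactOperatorAlgebra (A : Type u) [NonUnitalCStarAlgebra A] : Prop :=
  ∃ (H : Type z) (_ : NormedAddCommGroup H) (_ : InnerProductSpace ℂ H) (_ : CompleteSpace H)
    (π : A →⋆ₙₐ[ℂ] (H →L[ℂ] H)), Function.Injective π ∧ ∀ a : A, IsCompactOperator (π a)

section States

variable (A : Type u) [NonUnitalCStarAlgebra A] [PartialOrder A]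

/-- The states of `A`: positive linear functionals of norm one. -/
def states : Set (A →L[ℂ] ℂ) :=
  {f | (∀ a : A, 0 ≤ a → 0 ≤ f a) ∧ ‖f‖ = 1}

/-- The pure states of `A`: the extreme points of the convex set of states. -/
def pureStates : Set (A →L[ℂ] ℂ) :=
  Set.extremePoints ℝ (states A)

end States

section Modules

variable (A : Type u) [NonUnitalCStarAlgebra A] [PartialOrder A] [StarOrderedRing A]
  {X : Type v} [NormedAddCommGroup X] [NormedSpace ℂ X] [SMul A X] [CStarModule A X]
  {Y : Type w} [NormedAddCommGroup Y] [NormedSpace ℂ Y] [SMul A Y] [CStarModule A Y]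

/-- The element `|x| ∈ A`: the positive square root of `⟨x, x⟩`. -/
def absElt (x : X) : A := CFC.sqrt (inner A x x)

/-- A bounded `ℂ`-sesquilinear form `B : X × Y → A` is `A`-sesquilinear if it is `A`-linear in the
second variable and `A`-antilinear in the first one. The order of the factors is that of
Mathlib's `A`-valued inner products: `⟨x, a • y⟩ = a * ⟨x, y⟩` and `⟨a • x, y⟩ = ⟨x, y⟩ * star a`. -/
def IsASesquilinear (B : X →L⋆[ℂ] Y →L[ℂ] A) : Prop :=
  (∀ (a : A) (x : X) (y : Y), B x (a • y) = a * B x y) ∧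
  (∀ (a : A) (x : X) (y : Y), B (a • x) y = B x y * star a)

/-- A map between modules commutes with the action of `A`. -/
def IsALinear (T : X →L[ℂ] Y) : Prop :=
  ∀ (a : A) (x : X), T (a • x) = a • T x

/-- `T` has a (bounded) adjoint with respect to the `A`-valued inner products. -/
def IsAdjointable (T : X →L[ℂ] Y) : Prop :=
  ∃ S : Y →L[ℂ] X, ∀ (x : X) (y : Y), inner A (T x) y = inner A x (S y)

variable (X) in
/-- `X` is self-dual (the Riesz theorem holds for `X`): every bounded `A`-linear map `τ : X → A`
is of the form `⟨x, ·⟩` for some `x` in `X`. -/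
def IsSelfDual : Prop :=
  ∀ τ : X →L[ℂ] A, (∀ (a : A) (y : X), τ (a • y) = a * τ y) →
    ∃ x : X, ∀ y : X, τ y = inner A x y

end Modules

end HilbertCStar

end

/-! In an algebra of compact operators every nonzero positive `a` has a projection `p` with `a p =
‖a‖ p` and `p A p = ℂ p`: take one of minimal rank below the eigenprojection of `a` at `‖a‖`
(`exists_isMinimalProjection`). Such a `p` reduces everything to Hilbert spaces: `p a p = f(a) p`
defines a pure state `f`, and `f⟨x, y⟩` makes the corner `p X` a Hilbert space. The vectors `p x`
span a dense subspace, so a closed subspace containing all of them is the whole module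
(`eq_top_of_forall_smul_mem`).

Riesz may fail for bounded `A`-linear maps `Y → A`, but `B(p x, ·)` has values in `A p`, and for
such maps Riesz on the Hilbert space `p Y` suffices. The `x` for which `B(x, ·)` is representable
form a closed subspace, hence all of `X`; this gives `T`, and the form `B(x, y)⋆` gives its adjoint
`S`.

Choosing `p` with `|x| p = ‖x‖ p` gives `f(|x|) = ‖x‖`, so coercivity at this one pure state yields
`c k ‖x‖ ≤ ‖T x‖`, and similarly for `S`. Hence `T` has closed range and `S` is injective. Inside
each `p Y` a vector orthogonal to the range of `T` is killed by `S`, so the range contains every `p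
Y` and `T` is onto.

For the failure of Riesz, representing the identity map of the compact operators on `ℓ²` as `⟨x, ·⟩`
would force `x⋆ = 1`, which is not compact. -/

noncomputable section

namespace HilbertCStar

/-! ### Spectral theory of positive compact operators -/

section Operators

variable {H : Type*} [NormedAddCommGroup H] [InnerProductSpace ℂ H]

/-- The eigenvalues of a compact operator along an orthonormal sequence of eigenvectors are not
bounded away from zero. -/
theorem exists_norm_eigenvalue_lt {T : H →L[ℂ] H} (hT : IsCompactOperator T)
    {v : ℕ → H} (hv : Orthonormal ℂ v) {c : ℕ → ℂ} (hc : ∀ n, T (v n) = c n • v n)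
    {ε : ℝ} (hε : 0 < ε) : ∃ n, ‖c n‖ < ε := by
  by_contra! h
  have hK := hT.isCompact_closure_image_closedBall 1
  obtain ⟨y, -, φ, hφ, hlim⟩ := hK.tendsto_subseq (x := fun n => T (v n)) fun n =>
    subset_closure ⟨v n, by simp [hv.1 n], rfl⟩
  obtain ⟨N, hN⟩ := Metric.cauchySeq_iff'.mp hlim.cauchySeq ε hε
  have h1 := hN (N + 1) (Nat.le_succ N)
  have hne : φ (N + 1) ≠ φ N := (hφ (Nat.lt_succ_self N)).ne'
  simp only [Function.comp_apply, hc, dist_eq_norm] at h1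
  -- By Pythagoras the images of two different `v n` are at distance at least `√2 ε`, so no
  -- subsequence of images is Cauchy.
  have h2 := norm_sub_sq (𝕜 := ℂ) (c (φ (N + 1)) • v (φ (N + 1))) (c (φ N) • v (φ N))
  rw [inner_smul_left, inner_smul_right, hv.2 hne] at h2
  simp only [norm_smul, hv.1, mul_one, mul_zero, map_zero, sub_zero] at h2
  nlinarith [h (φ (N + 1)), h (φ N), norm_nonneg (c (φ (N + 1)) • v (φ (N + 1)) - c (φ N) • v (φ N))]

variable [CompleteSpace H]

/-- A positive compact operator has its norm as an eigenvalue. -/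
theorem exists_eigenvector_norm {T : H →L[ℂ] H} (hT : IsCompactOperator T) (h0 : 0 ≤ T)
    (hne : T ≠ 0) : ∃ v : H, v ≠ 0 ∧ T v = (‖T‖ : ℂ) • v := by
  have : Nontrivial (H →L[ℂ] H) := ⟨T, 0, hne⟩
  have h1 : ‖T‖ ∈ spectrum ℝ T := CStarAlgebra.norm_mem_spectrum_of_nonneg h0
  have h2 : (‖T‖ : ℂ) ∈ spectrum ℂ T := by
    simpa using spectrum.algebraMap_mem ℂ h1
  have hn : (‖T‖ : ℂ) ≠ 0 := by simpa using hne
  obtain ⟨v, hv⟩ := ((hT.hasEigenvalue_iff_mem_spectrum hn).mpr h2).exists_hasEigenvector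
  exact ⟨v, hv.2, hv.apply_eq_smul⟩

/-- The powers of a positive compact operator of norm one converge to the projection onto the
eigenspace of the eigenvalue one. -/
theorem exists_tendsto_pow {T : H →L[ℂ] H} (hT : IsCompactOperator T) (h0 : 0 ≤ T)
    (h1 : ‖T‖ = 1) :
    ∃ E : H →L[ℂ] H, E ≠ 0 ∧ star E = E ∧ E * E = E ∧ T * E = E ∧
      Filter.Tendsto (fun n : ℕ => T ^ (n + 1)) Filter.atTop (nhds E) := by
  have hne : T ≠ 0 := by rintro rfl; simp at h1
  obtain ⟨v, hv0, hv⟩ := exists_eigenvector_norm hT h0 hne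
  set V : Submodule ℂ H := LinearMap.ker ((T - 1 : H →L[ℂ] H) : H →ₗ[ℂ] H) with hV
  have memV : ∀ w, w ∈ V ↔ T w = w := fun w => by
    simp [hV, LinearMap.mem_ker, sub_eq_zero]
  have hVc : IsClosed (V : Set H) := (T - 1 : H →L[ℂ] H).isClosed_ker
  have : CompleteSpace V := hVc.completeSpace_coe
  set E : H →L[ℂ] H := V.starProjection with hE
  have hEmem : ∀ w, E w ∈ V := fun w => V.starProjection_apply_mem w
  have hEs : star E = E := isSelfAdjoint_starProjection V
  have hfix : ∀ w ∈ V, E w = w := fun w hw => V.starProjection_eq_self_iff.mpr hw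
  have hEE : E * E = E := by ext w; exact hfix _ (hEmem w)
  have hTE : T * E = E := by ext w; exact (memV _).mp (hEmem w)
  have hTs : star T = T := (IsSelfAdjoint.of_nonneg h0).star_eq
  have hET : E * T = E := by simpa [hEs, hTs] using congrArg star hTE
  have hvV : v ∈ V := by rw [memV, hv, h1]; simp
  have hE0 : E ≠ 0 := fun h => hv0 (by rw [← hfix v hvV, h]; rfl)
  have hS : T - E = (1 - E) * T * (1 - E) := by
    simp [sub_mul, mul_sub, hTE, hET, hEE]
  have hSc : IsCompactOperator (T - E : H →L[ℂ] H) := by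
    have : T - E = T * (1 - E) := by simp [mul_sub, hTE]
    rw [this]
    exact hT.comp_clm (1 - E)
  have hS0 : 0 ≤ T - E := by
    rw [hS]
    have := star_left_conjugate_nonneg h0 (1 - E)
    simpa [hEs] using this
  -- `T - E` is positive and compact, so norm one would produce a nonzero vector fixed by `T - E`.
  -- It is killed by `E`, hence fixed by `T`, hence in the range of `E`: a contradiction.
  have hSle : ‖T - E‖ < 1 := by
    have hle : ‖T - E‖ ≤ 1 := by
      rw [← h1]
      refine CStarAlgebra.norm_le_norm_of_nonneg_of_le hS0 ?_
      have : 0 ≤ E := by simpa [hEs, hEE] using star_mul_self_nonneg E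
      simpa using this
    refine lt_of_le_of_ne hle fun h => ?_
    obtain ⟨w, hw0, hw⟩ := exists_eigenvector_norm hSc hS0 (by rintro h'; simp [h'] at h)
    rw [h] at hw
    simp only [Complex.ofReal_one, one_smul] at hw
    have hEw : E w = 0 := by
      have : E * (T - E) = 0 := by simp [mul_sub, hET, hEE]
      rw [← hw, ← mul_apply_eq_comp, this]
      rfl
    have hTw : w ∈ V := by
      rw [memV]
      simpa [hEw] using hw
    exact hw0 (by rw [← hfix w hTw, hEw])
  -- False for exponent zero since `E ≠ 0`. Positive powers also stay inside a nonunital algebra.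
  have hpow : ∀ n : ℕ, T ^ (n + 1) = E + (T - E) ^ (n + 1) := by
    intro n
    induction n with
    | zero => simp
    | succ n ih =>
      have hz : ∀ m : ℕ, E * (T - E) ^ (m + 1) = 0 := fun m => by
        rw [pow_succ', ← mul_assoc]
        simp [mul_sub, hET, hEE]
      rw [pow_succ' T, ih, mul_add, hTE, pow_succ' (T - E) (n + 1), sub_mul, hz, sub_zero]
  refine ⟨E, hE0, hEs, hEE, hTE, ?_⟩
  simp_rw [hpow]
  have := (tendsto_pow_atTop_nhds_zero_of_norm_lt_one hSle).comp (Filter.tendsto_add_atTop_nat 1)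
  simpa using tendsto_const_nhds.add this

end Operators

/-- A projection `p` of a C⋆-algebra `A` is minimal if it is nonzero and `p A p = ℂ p`. -/
structure IsMinimalProjection {A : Type u} [NonUnitalCStarAlgebra A] (p : A) : Prop where
  ne_zero : p ≠ 0
  star_eq : star p = p
  mul_self : p * p = p
  exists_smul : ∀ a : A, ∃ c : ℂ, p * a * p = c • p

/-! ### Existence of minimal projections -/

section Projections

variable {A : Type u} [NonUnitalCStarAlgebra A] [PartialOrder A] [StarOrderedRing A]
  {H : Type z} [NormedAddCommGroup H] [InnerProductSpace ℂ H] [CompleteSpace H]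
  {π : A →⋆ₙₐ[ℂ] (H →L[ℂ] H)}

/-- The eigenprojection of a positive element `a ≠ 0` at its norm belongs to the algebra. -/
theorem exists_eigenprojection (hinj : Function.Injective π)
    (hcpt : ∀ a : A, IsCompactOperator (π a)) {a : A} (h0 : 0 ≤ a) (hne : a ≠ 0) :
    ∃ e : A, e ≠ 0 ∧ star e = e ∧ e * e = e ∧ a * e = (‖a‖ : ℂ) • e := by
  have hn : (‖a‖ : ℂ) ≠ 0 := by simpa using hne
  set b : A := (‖a‖⁻¹ : ℝ) • a with hb
  have hb0 : 0 ≤ b := smul_nonneg (by positivity) h0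
  have hb1 : ‖b‖ = 1 := by
    rw [hb, norm_smul, norm_inv, norm_norm, inv_mul_cancel₀ (by simpa using hne)]
  have hiso := NonUnitalStarAlgHom.isometry π hinj
  obtain ⟨E, hE0, hEs, hEE, hTE, hlim⟩ := exists_tendsto_pow (hcpt b) (map_nonneg π hb0)
    (by rw [NonUnitalStarAlgHom.norm_map π hinj, hb1])
  have hmem : ∀ n : ℕ, π b ^ (n + 1) ∈ Set.range π := by
    intro n
    induction n with
    | zero => exact ⟨b, by simp⟩
    | succ n ih =>
      obtain ⟨d, hd⟩ := ih
      exact ⟨d * b, by rw [map_mul, hd, pow_succ (π b) (n + 1)]⟩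
  -- A faithful representation is isometric, so its range is closed and contains the limit of the
  -- powers.
  obtain ⟨e, rfl⟩ := hiso.isClosedEmbedding.isClosed_range.mem_of_tendsto hlim
    (Filter.Eventually.of_forall hmem)
  refine ⟨e, by rintro rfl; simp at hE0, hinj (by rw [map_star, hEs]), hinj (by simpa using hEE), ?_⟩
  have hbe : b * e = e := hinj (by simpa using hTE)
  have ha : a = (‖a‖ : ℂ) • b := by
    rw [hb, ← Complex.coe_smul, smul_smul]
    simp [hn]
  conv_lhs => rw [ha]
  rw [smul_mul_assoc, hbe]

open Module.End in
/-- A C⋆-algebra of compact operators has a minimal projection below the eigenprojection of a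
positive element at its norm. -/
theorem exists_isMinimalProjection (hinj : Function.Injective π)
    (hcpt : ∀ a : A, IsCompactOperator (π a)) {a : A} (h0 : 0 ≤ a) (hne : a ≠ 0) :
    ∃ p : A, IsMinimalProjection p ∧ a * p = (‖a‖ : ℂ) • p := by
  obtain ⟨e, he0, hes, hee, hae⟩ := exists_eigenprojection hinj hcpt h0 hne
  let V : A → Submodule ℂ H := fun q => eigenspace (π q : H →ₗ[ℂ] H) 1
  have memV : ∀ q w, w ∈ V q ↔ π q w = w := fun q w => by
    simp only [V, mem_eigenspace_iff, one_smul, ContinuousLinearMap.coe_coe]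
  have hfin : ∀ q, FiniteDimensional ℂ (V q) := fun q =>
    ContinuousLinearMap.finite_dimensional_eigenspace (hcpt q) 1 one_ne_zero
  let P : A → Prop := fun q => q ≠ 0 ∧ star q = q ∧ q * q = q ∧ e * q = q
  have hex : ∃ n, ∃ q, P q ∧ Module.finrank ℂ (V q) = n := ⟨_, e, ⟨he0, hes, hee, hee⟩, rfl⟩
  classical
  obtain ⟨p, ⟨hp0, hps, hpp, hep⟩, hrank⟩ := Nat.find_spec hex
  have hmin : ∀ q, P q → Module.finrank ℂ (V p) ≤ Module.finrank ℂ (V q) := fun q hq =>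
    hrank.trans_le (Nat.find_min' hex ⟨q, hq, rfl⟩)
  -- The eigenprojection `q` of `b` at `‖b‖` lies below `p`; minimality of the rank forces `q = p`,
  -- so `b = ‖b‖ p`.
  have hpos : ∀ b : A, 0 ≤ b → p * b = b → b * p = b → ∃ c : ℂ, b = c • p := by
    intro b hb0 hpb hbp
    rcases eq_or_ne b 0 with rfl | hb
    · exact ⟨0, by simp⟩
    obtain ⟨q, hq0, hqs, hqq, hbq⟩ := exists_eigenprojection hinj hcpt hb0 hb
    have hbn : (‖b‖ : ℂ) ≠ 0 := by simpa using hb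
    have hpq : p * q = q := by
      have h1 : (‖b‖ : ℂ) • (p * q) = (‖b‖ : ℂ) • q := by
        rw [← mul_smul_comm, ← hbq, ← mul_assoc, hpb]
      exact smul_right_injective A hbn h1
    have hle : V q ≤ V p := by
      intro w hw
      rw [memV] at hw ⊢
      rw [← hw, ← mul_apply_eq_comp, ← map_mul, hpq]
    have hVeq : V q = V p :=
      Submodule.eq_of_le_of_finrank_le hle (hmin q ⟨hq0, hqs, hqq, by rw [← hpq, ← mul_assoc, hep]⟩)
    have hqp : q * p = p := by
      apply hinj
      ext w
      have hw : π p w ∈ V q := by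
        rw [hVeq, memV, ← mul_apply_eq_comp, ← map_mul, hpp]
      rw [map_mul]
      exact (memV _ _).mp hw
    refine ⟨‖b‖, ?_⟩
    calc b = b * q * p := by rw [mul_assoc, hqp, hbp]
      _ = _ := by rw [hbq, smul_mul_assoc, hqp]
  refine ⟨p, ⟨hp0, hps, hpp, fun b => ?_⟩, ?_⟩
  · have hb : b ∈ Submodule.span ℂ {b : A | 0 ≤ b} := by
      rw [CStarAlgebra.span_nonneg]
      trivial
    induction hb using Submodule.span_induction with
    | mem b hb =>
      refine hpos _ ?_ (by simp only [← mul_assoc, hpp]) (by simp only [mul_assoc, hpp])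
      simpa [hps] using star_left_conjugate_nonneg hb p
    | zero => exact ⟨0, by simp⟩
    | add x y _ _ hx hy =>
      obtain ⟨c, hc⟩ := hx
      obtain ⟨d, hd⟩ := hy
      exact ⟨c + d, by rw [mul_add, add_mul, hc, hd, add_smul]⟩
    | smul t x _ hx =>
      obtain ⟨c, hc⟩ := hx
      exact ⟨t * c, by rw [mul_smul_comm, smul_mul_assoc, hc, mul_smul]⟩
  · rw [← hep, ← mul_assoc, hae, smul_mul_assoc]

end Projections

/-! ### The functional of a minimal projection and its purity -/

namespace IsMinimalProjection

variable {A : Type u} [NonUnitalCStarAlgebra A] {p : A}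

theorem norm_eq_one (hp : IsMinimalProjection p) : ‖p‖ = 1 := by
  have h1 := CStarRing.norm_star_mul_self (x := p)
  rw [hp.star_eq, hp.mul_self] at h1
  have h2 : ‖p‖ ≠ 0 := by simpa using hp.ne_zero
  exact (mul_right_cancel₀ h2 (by rw [one_mul]; exact h1)).symm

theorem smul_left_injective (hp : IsMinimalProjection p) {c d : ℂ} (h : c • p = d • p) : c = d :=
  _root_.smul_left_injective ℂ hp.ne_zero h

/-- The functional `f` with `p a p = f(a) p` that a minimal projection `p` defines. -/
def functional (hp : IsMinimalProjection p) : A →L[ℂ] ℂ :=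
  LinearMap.mkContinuous
    { toFun := fun a => (hp.exists_smul a).choose
      map_add' := fun a b => hp.smul_left_injective <| by
        rw [add_smul, ← (hp.exists_smul a).choose_spec, ← (hp.exists_smul b).choose_spec,
          ← (hp.exists_smul (a + b)).choose_spec, mul_add, add_mul]
      map_smul' := fun c a => hp.smul_left_injective <| by
        rw [RingHom.id_apply, smul_assoc, ← (hp.exists_smul a).choose_spec,
          ← (hp.exists_smul (c • a)).choose_spec, mul_smul_comm, smul_mul_assoc] } 1 <| fun a => by
    change ‖(hp.exists_smul a).choose‖ ≤ _
    have h1 := congrArg norm (hp.exists_smul a).choose_spec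
    rw [norm_smul, hp.norm_eq_one, mul_one] at h1
    rw [← h1]
    calc ‖p * a * p‖ ≤ ‖p‖ * ‖a‖ * ‖p‖ :=
        (norm_mul_le _ _).trans (by gcongr; exact norm_mul_le _ _)
      _ = 1 * ‖a‖ := by rw [hp.norm_eq_one]; ring

theorem mul_mul_eq (hp : IsMinimalProjection p) (a : A) : p * a * p = hp.functional a • p :=
  (hp.exists_smul a).choose_spec

theorem functional_eq (hp : IsMinimalProjection p) {a : A} {c : ℂ} (h : p * a * p = c • p) :
    hp.functional a = c :=
  hp.smul_left_injective (by rw [← hp.mul_mul_eq, h])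

theorem functional_self (hp : IsMinimalProjection p) : hp.functional p = 1 :=
  hp.functional_eq (by rw [hp.mul_self, hp.mul_self, one_smul])

theorem functional_star (hp : IsMinimalProjection p) (a : A) :
    hp.functional (star a) = star (hp.functional a) := by
  apply hp.functional_eq
  have := congrArg star (hp.mul_mul_eq a)
  simpa [hp.star_eq, mul_assoc] using this

theorem norm_functional (hp : IsMinimalProjection p) : ‖hp.functional‖ = 1 := by
  refine le_antisymm (LinearMap.mkContinuous_norm_le _ zero_le_one _) ?_
  have := hp.functional.le_opNorm p
  rwa [hp.functional_self, hp.norm_eq_one, norm_one, mul_one] at this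

theorem norm_functional_le (hp : IsMinimalProjection p) (a : A) : ‖hp.functional a‖ ≤ ‖a‖ := by
  simpa [hp.norm_functional] using hp.functional.le_opNorm a

end IsMinimalProjection

section Pure

variable {A : Type u} [NonUnitalCStarAlgebra A]

/-- A functional of norm one with value one at a projection `p` vanishes on `b` if `p b = 0`. -/
theorem apply_eq_zero_of_mul_eq_zero {p : A} (hs : star p = p) (hm : p * p = p)
    {g : A →L[ℂ] ℂ} (hg : ‖g‖ = 1) (hgp : g p = 1) {b : A} (hb : p * b = 0 ∨ b * p = 0) :
    g b = 0 := by
  have hp1 : ‖p‖ ≤ 1 := by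
    have h1 := CStarRing.norm_star_mul_self (x := p)
    rw [hs, hm] at h1
    nlinarith [norm_nonneg p]
  -- Since `p b = 0` or `b p = 0`, the cross terms vanish in one of the two C⋆-products. The squared
  -- norm thus has no term linear in `t`, whereas `g (p + t b) = 1 + t g(b)` has one unless `g b =
  -- 0`.
  have hnorm : ∀ t : ℂ, ‖p + t • b‖ ^ 2 ≤ 1 + ‖t‖ ^ 2 * ‖b‖ ^ 2 := by
    intro t
    have hbb : ‖(star t * t) • (star b * b)‖ = ‖t‖ ^ 2 * ‖b‖ ^ 2 ∧
        ‖(t * star t) • (b * star b)‖ = ‖t‖ ^ 2 * ‖b‖ ^ 2 := by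
      rw [norm_smul, norm_smul, CStarRing.norm_star_mul_self, CStarRing.norm_self_mul_star,
        CStarRing.norm_star_mul_self, CStarRing.norm_self_mul_star, pow_two, pow_two]
      exact ⟨rfl, rfl⟩
    rcases hb with hb | hb
    · have hb' : star b * p = 0 := by simpa [hs] using congrArg star hb
      have h1 : star (p + t • b) * (p + t • b) = p + (star t * t) • (star b * b) := by
        simp [add_mul, mul_add, smul_mul_assoc, mul_smul_comm, hs, hm, hb, hb', smul_smul, mul_comm t]
      rw [pow_two, ← CStarRing.norm_star_mul_self, h1]
      exact (norm_add_le _ _).trans (add_le_add hp1 hbb.1.le)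
    · have hb' : p * star b = 0 := by simpa [hs] using congrArg star hb
      have h1 : (p + t • b) * star (p + t • b) = p + (t * star t) • (b * star b) := by
        simp [add_mul, mul_add, smul_mul_assoc, mul_smul_comm, hs, hm, hb, hb', smul_smul, mul_comm t]
      rw [pow_two, ← CStarRing.norm_self_mul_star, h1]
      exact (norm_add_le _ _).trans (add_le_add hp1 hbb.2.le)
  have hle : ∀ s : ℝ, 2 * s * ‖g b‖ ^ 2 ≤ s ^ 2 * (‖g b‖ ^ 2 * ‖b‖ ^ 2) := by
    intro s
    have h1 := hnorm ((s : ℂ) * star (g b))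
    have h2 : ‖g (p + ((s : ℂ) * star (g b)) • b)‖ ≤ ‖p + ((s : ℂ) * star (g b)) • b‖ := by
      simpa [hg] using g.le_opNorm (p + ((s : ℂ) * star (g b)) • b)
    have h3 : g (p + ((s : ℂ) * star (g b)) • b) = ((1 + s * ‖g b‖ ^ 2 : ℝ) : ℂ) := by
      rw [map_add, map_smul, hgp, smul_eq_mul, mul_assoc]
      have : star (g b) * g b = ((‖g b‖ ^ 2 : ℝ) : ℂ) := by
        simpa using Complex.conj_mul' (g b)
      rw [this]
      push_cast
      ring
    rw [h3, Complex.norm_real, Real.norm_eq_abs] at h2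
    have h4 : (1 + s * ‖g b‖ ^ 2) ^ 2 ≤ ‖p + ((s : ℂ) * star (g b)) • b‖ ^ 2 := by
      rw [← sq_abs]
      gcongr
    have h5 : ‖(s : ℂ) * star (g b)‖ ^ 2 = s ^ 2 * ‖g b‖ ^ 2 := by
      simp [mul_pow]
    rw [h5] at h1
    nlinarith [sq_nonneg (s * ‖g b‖ ^ 2)]
  by_contra hne
  have hpos : 0 < ‖g b‖ ^ 2 := by positivity
  -- This `s` satisfies `s ‖b‖² < 1`, while dividing the inequality by `s ‖g b‖²` would give `2 ≤ s
  -- ‖b‖²`.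
  have h1 := hle (1 / (‖b‖ ^ 2 + 1))
  have hd : 0 < ‖b‖ ^ 2 + 1 := by positivity
  have h2 : 2 * (1 / (‖b‖ ^ 2 + 1)) ≤ (1 / (‖b‖ ^ 2 + 1)) ^ 2 * ‖b‖ ^ 2 := by
    nlinarith
  rw [div_pow, one_pow, div_mul_eq_mul_div, one_mul, mul_one_div,
    div_le_div_iff₀ hd (by positivity)] at h2
  nlinarith [sq_nonneg ‖b‖, mul_pos hd hd]

variable [PartialOrder A] [StarOrderedRing A] {p : A}

/-- `p a p` is positive, and a negative multiple of the nonzero positive element `p` is not. -/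
theorem IsMinimalProjection.functional_nonneg (hp : IsMinimalProjection p) {a : A} (ha : 0 ≤ a) :
    0 ≤ hp.functional a := by
  have h2 := star_left_conjugate_nonneg ha p
  rw [hp.star_eq, hp.mul_mul_eq] at h2
  have hreal : hp.functional a = ((hp.functional a).re : ℂ) := by
    refine (Complex.conj_eq_iff_re.mp ?_).symm
    have := hp.functional_star a
    rw [(IsSelfAdjoint.of_nonneg ha).star_eq] at this
    exact this.symm
  by_contra hneg
  rw [hreal] at h2 hneg
  have hlt : (hp.functional a).re < 0 := by simpa using hneg
  have hp0 : 0 ≤ p := by simpa [hp.star_eq, hp.mul_self] using star_mul_self_nonneg p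
  have h3 : 0 ≤ (-(hp.functional a).re) • p := smul_nonneg (by linarith) hp0
  rw [Complex.coe_smul] at h2
  rw [neg_smul, neg_nonneg] at h3
  have h4 := le_antisymm h3 h2
  rcases smul_eq_zero.mp h4 with h | h
  · linarith
  · exact hp.ne_zero h

/-- The functional of a minimal projection is a pure state. -/
theorem IsMinimalProjection.functional_mem_pureStates (hp : IsMinimalProjection p) :
    hp.functional ∈ pureStates A := by
  -- The value one at `p` determines a state: `g(a) = g(p a) = g(p a p) = f(a) g(p)`. In a convex
  -- decomposition of the functional both parts must attain their maximal value one at `p`.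
  have key : ∀ g ∈ states A, g p = 1 → g = hp.functional := by
    intro g hg hgp
    ext a
    have h1 : g (a - p * a) = 0 :=
      apply_eq_zero_of_mul_eq_zero hp.star_eq hp.mul_self hg.2 hgp
        (Or.inl (by rw [mul_sub, ← mul_assoc, hp.mul_self, sub_self]))
    have h2 : g (p * a - p * a * p) = 0 :=
      apply_eq_zero_of_mul_eq_zero hp.star_eq hp.mul_self hg.2 hgp
        (Or.inr (by rw [sub_mul, mul_assoc (p * a), hp.mul_self, sub_self]))
    rw [map_sub, sub_eq_zero] at h1 h2
    rw [h1, h2, hp.mul_mul_eq, map_smul, hgp, smul_eq_mul, mul_one]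
  refine ⟨⟨fun a ha => hp.functional_nonneg ha, hp.norm_functional⟩, ?_⟩
  rintro g hg h hh ⟨s, t, hs, ht, hst, hsum⟩
  refine key g hg ?_
  have hle : ∀ g ∈ states A, (g p).re ≤ 1 := fun g hg => by
    have := g.le_opNorm p
    rw [hg.2, hp.norm_eq_one, one_mul] at this
    exact (Complex.re_le_norm _).trans this
  have him : (g p).im = 0 := by
    have hp0 : 0 ≤ p := by simpa [hp.star_eq, hp.mul_self] using star_mul_self_nonneg p
    exact (Complex.le_def.mp (hg.1 p hp0)).2.symm
  have h1 : s * (g p).re + t * (h p).re = 1 := by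
    have := congrArg (fun f : A →L[ℂ] ℂ => (f p).re) hsum
    simpa [hp.functional_self] using this
  have h2 := hle g hg
  have h3 := hle h hh
  apply Complex.ext
  · simp only [Complex.one_re]
    nlinarith
  · simpa using him

end Pure

section CompactAlgebra

variable {A : Type u} [NonUnitalCStarAlgebra A] [PartialOrder A] [StarOrderedRing A]

theorem IsCompactOperatorAlgebra.exists_isMinimalProjection
    (hA : IsCompactOperatorAlgebra.{u, z} A) {a : A} (h0 : 0 ≤ a) (hne : a ≠ 0) :
    ∃ p : A, IsMinimalProjection p ∧ a * p = (‖a‖ : ℂ) • p := by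
  obtain ⟨H, _, _, _, π, hinj, hcpt⟩ := hA
  exact HilbertCStar.exists_isMinimalProjection hinj hcpt h0 hne

/-- An element of a C⋆-algebra of compact operators annihilated by all minimal projections
vanishes. -/
theorem IsCompactOperatorAlgebra.eq_zero_of_forall_mul_eq_zero
    (hA : IsCompactOperatorAlgebra.{u, z} A) {a : A}
    (h : ∀ p : A, IsMinimalProjection p → p * a = 0) : a = 0 := by
  by_contra hne
  have hne' : a * star a ≠ 0 := by rwa [Ne, CStarRing.mul_star_self_eq_zero_iff]
  obtain ⟨p, hp, hap⟩ := hA.exists_isMinimalProjection (mul_star_self_nonneg a) hne'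
  have h1 : star a * p = 0 := by simpa [hp.star_eq] using congrArg star (h p hp)
  rw [mul_assoc, h1, mul_zero] at hap
  rcases smul_eq_zero.mp hap.symm with h2 | h2
  · exact hne' (by simpa using h2)
  · exact hp.ne_zero h2

end CompactAlgebra

/-! ### Module laws and density of the corners -/

section Action

variable {A : Type u} [NonUnitalCStarAlgebra A] [PartialOrder A]
  {X : Type v} [NormedAddCommGroup X] [NormedSpace ℂ X] [SMul A X] [CStarModule A X]

/-- The action of `A` is a bare `SMul`; its algebraic laws are recovered by testing against inner
products. -/
theorem ext_inner_right {x y : X} (h : ∀ z : X, inner A z x = inner A z y) : x = y := by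
  rw [← sub_eq_zero, ← CStarModule.inner_self (A := A), CStarModule.inner_sub_right, h, sub_self]

theorem ext_inner_left {x y : X} (h : ∀ z : X, inner A x z = inner A y z) : x = y := by
  rw [← sub_eq_zero, ← CStarModule.inner_self (A := A), CStarModule.inner_sub_left, h, sub_self]

theorem mul_smul_eq (a b : A) (x : X) : (a * b) • x = a • b • x :=
  ext_inner_right (A := A) fun z => by simp [mul_assoc]

theorem norm_smul_le_mul (a : A) (x : X) : ‖a • x‖ ≤ ‖a‖ * ‖x‖ := by
  refine abs_le_of_sq_le_sq' ?_ (by positivity) |>.2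
  rw [CStarModule.norm_sq_eq A, mul_pow, CStarModule.norm_sq_eq A (x := x), CStarModule.inner_op_smul_right,
    CStarModule.inner_op_smul_left]
  calc ‖a * (inner A x x * star a)‖ ≤ ‖a‖ * (‖inner A x x‖ * ‖star a‖) :=
        (norm_mul_le _ _).trans (by gcongr; exact norm_mul_le _ _)
    _ = _ := by rw [norm_star]; ring

variable (X) in
/-- The action of an element of `A` on a Hilbert module, as a bounded operator. -/
def actionCLM (a : A) : X →L[ℂ] X :=
  LinearMap.mkContinuous
    { toFun := fun x => a • x
      map_add' := fun x y => ext_inner_right (A := A) fun z => by simp [mul_add]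
      map_smul' := fun c x => ext_inner_right (A := A) fun z => by simp [mul_smul_comm] } ‖a‖
    fun x => norm_smul_le_mul a x

@[simp]
theorem actionCLM_apply (a : A) (x : X) : actionCLM X a x = a • x := rfl

end Action

section Greedy

variable {A : Type u} [NonUnitalCStarAlgebra A] [PartialOrder A] [StarOrderedRing A]
  {X : Type v} [NormedAddCommGroup X] [NormedSpace ℂ X] [SMul A X] [CStarModule A X]

/-- Mutually orthogonal projections whose images consist of eigenvectors of an element of a
C⋆-algebra of compact operators belong to arbitrarily small eigenvalues. -/
theorem IsCompactOperatorAlgebra.exists_norm_eigenvalue_lt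
    (hA : IsCompactOperatorAlgebra.{u, z} A) {a : A} {p : ℕ → A} {c : ℕ → ℂ}
    (hp : ∀ n, IsMinimalProjection (p n)) (hort : ∀ m n, m < n → p m * p n = 0)
    (hc : ∀ n, a * p n = c n • p n) {ε : ℝ} (hε : 0 < ε) : ∃ n, ‖c n‖ < ε := by
  obtain ⟨H, _, _, _, π, hinj, hcpt⟩ := hA
  have hv : ∀ n, ∃ v : H, ‖v‖ = 1 ∧ π (p n) v = v := by
    intro n
    have h1 : π (p n) ≠ 0 := fun h => (hp n).ne_zero (hinj (by rw [h, map_zero]))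
    obtain ⟨w, hw⟩ : ∃ w, π (p n) w ≠ 0 := by
      by_contra! h
      exact h1 (ContinuousLinearMap.ext h)
    refine ⟨((‖π (p n) w‖⁻¹ : ℝ) : ℂ) • π (p n) w, ?_, ?_⟩
    · rw [norm_smul, Complex.norm_real, norm_inv, norm_norm, inv_mul_cancel₀ (by simpa using hw)]
    · rw [map_smul, ← mul_apply_eq_comp, ← map_mul, (hp n).mul_self]
  choose v hv1 hv2 using hv
  have hlt : ∀ m n, m < n → inner ℂ (v m) (v n) = 0 := fun m n hmn => by
    rw [← hv2 m, ← hv2 n, ← ContinuousLinearMap.adjoint_inner_right,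
      ← ContinuousLinearMap.star_eq_adjoint, ← map_star, (hp m).star_eq, ← mul_apply_eq_comp,
      ← map_mul, hort m n hmn]
    simp
  refine HilbertCStar.exists_norm_eigenvalue_lt (hcpt a) (v := v) ⟨hv1, fun m n hmn => ?_⟩
    (fun n => ?_) hε
  · rcases lt_or_gt_of_ne hmn with h | h
    · exact hlt m n h
    · rw [← inner_conj_symm, hlt n m h, map_zero]
  · conv_lhs => rw [← hv2 n, ← mul_apply_eq_comp, ← map_mul, hc, map_smul]
    simp [hv2]

/-- In a Hilbert module over a C⋆-algebra of compact operators, the vectors `p x` with `p` a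
minimal projection span a dense subspace. -/
theorem IsCompactOperatorAlgebra.eq_top_of_forall_smul_mem
    (hA : IsCompactOperatorAlgebra.{u, z} A) (S : Submodule ℂ X) (hS : IsClosed (S : Set X))
    (h : ∀ (p : A) (x : X), IsMinimalProjection p → p • x ∈ S) : S = ⊤ := by
  rw [eq_top_iff]
  rintro x -
  by_contra hx
  -- The value at `y = 0` is a dummy; the recursion below never reaches it, since `s n = 0` would
  -- put `x` in `S`.
  have hP : ∀ y : X, ∃ p : A, y ≠ 0 →
      IsMinimalProjection p ∧ inner A y y * p = ((‖y‖ ^ 2 : ℝ) : ℂ) • p := by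
    intro y
    by_cases hy : y = 0
    · exact ⟨0, fun h => absurd hy h⟩
    obtain ⟨p, hp⟩ := hA.exists_isMinimalProjection (a := inner A y y)
      CStarModule.inner_self_nonneg (by rwa [Ne, CStarModule.inner_self])
    exact ⟨p, fun _ => by rwa [CStarModule.norm_sq_eq A]⟩
  choose P hP using hP
  let s : ℕ → X := fun n => Nat.rec x (fun _ y => y - P y • y) n
  have hs : ∀ n, s (n + 1) = s n - P (s n) • s n := fun n => rfl
  have hmem : ∀ n, x - s n ∈ S ∧ s n ≠ 0 := by
    have h1 : ∀ n, x - s n ∈ S → s n ≠ 0 := fun n hn h0 => hx (by simpa [h0] using hn)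
    intro n
    induction n with
    | zero =>
      have : x - s 0 ∈ S := by simp [s]
      exact ⟨this, h1 0 this⟩
    | succ n ih =>
      have : x - s (n + 1) ∈ S := by
        rw [hs, ← sub_add]
        exact S.add_mem ih.1 (h _ _ (hP _ ih.2).1)
      exact ⟨this, h1 (n + 1) this⟩
  set p : ℕ → A := fun n => P (s n) with hp
  set a : ℕ → A := fun n => inner A (s n) (s n) with ha
  set c : ℕ → ℂ := fun n => ((‖s n‖ ^ 2 : ℝ) : ℂ) with hc
  have hpmin : ∀ n, IsMinimalProjection (p n) := fun n => (hP _ (hmem n).2).1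
  have hap : ∀ n, a n * p n = c n • p n := fun n => (hP _ (hmem n).2).2
  have hc0 : ∀ n, c n ≠ 0 := fun n => by simpa [hc] using (hmem n).2
  have hpa : ∀ n, p n * a n = c n • p n := fun n => by
    have := congrArg star (hap n)
    simpa [(hpmin n).star_eq, ha, hc] using this
  -- Removing `p n • s n` deletes exactly the part of `⟨s n, s n⟩` at its top eigenvalue along `p
  -- n`. The projections are therefore orthogonal and all consist of eigenvectors of the initial
  -- element `⟨x, x⟩`, with eigenvalues `‖s n‖²`; compactness makes these arbitrarily small.
  have hstep : ∀ n, a (n + 1) = a n - c n • p n := fun n => by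
    have h1 : a (n + 1) = a n - a n * p n - (p n * a n - p n * (a n * p n)) := by
      simp only [ha, hs, CStarModule.inner_sub_left, CStarModule.inner_sub_right,
        CStarModule.inner_op_smul_left, CStarModule.inner_op_smul_right]
      rw [(hpmin n).star_eq, mul_sub]
    rw [h1, hap, hpa, mul_smul_comm, (hpmin n).mul_self, sub_self, sub_zero]
  have hpaz : ∀ m k, p m * a (m + 1 + k) = 0 ∧ p m * p (m + 1 + k) = 0 := by
    have h1 : ∀ m n, p m * a n = 0 → p m * p n = 0 := fun m n hmn => by
      have : c n • (p m * p n) = 0 := by rw [← mul_smul_comm, ← hap, ← mul_assoc, hmn, zero_mul]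
      exact (smul_eq_zero.mp this).resolve_left (hc0 n)
    intro m k
    induction k with
    | zero =>
      have : p m * a (m + 1) = 0 := by
        rw [hstep, mul_sub, hpa, mul_smul_comm, (hpmin m).mul_self, sub_self]
      exact ⟨this, h1 m (m + 1) this⟩
    | succ k ih =>
      have : p m * a (m + 1 + (k + 1)) = 0 := by
        rw [← add_assoc, hstep, mul_sub, ih.1, mul_smul_comm, ih.2, smul_zero, sub_zero]
      exact ⟨this, h1 m (m + 1 + (k + 1)) this⟩
  have hort : ∀ m n, m < n → p m * p n = 0 := fun m n hmn => by
    obtain ⟨k, rfl⟩ := Nat.exists_eq_add_of_le (Nat.succ_le_of_lt hmn)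
    exact (hpaz m k).2
  have heig : ∀ n k, k ≤ n → a k * p n = a 0 * p n := by
    intro n k
    induction k with
    | zero => intro _; rfl
    | succ k ih =>
      intro hk
      rw [hstep, sub_mul, smul_mul_assoc, hort k n hk, smul_zero, sub_zero, ih (by omega)]
  have hlim : ∀ ε > 0, ∃ n, ‖s n‖ < ε := fun ε hε => by
    obtain ⟨n, hn⟩ := hA.exists_norm_eigenvalue_lt (a := a 0) hpmin hort
      (fun n => by rw [← heig n n le_rfl, hap]) (pow_pos hε 2)
    refine ⟨n, lt_of_pow_lt_pow_left₀ 2 hε.le ?_⟩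
    simpa [hc] using hn
  refine hx (hS.closure_subset (Metric.mem_closure_iff.mpr fun ε hε => ?_))
  obtain ⟨n, hn⟩ := hlim ε hε
  exact ⟨x - s n, (hmem n).1, by simpa [dist_eq_norm] using hn⟩

end Greedy

/-! ### Corners as Hilbert spaces -/

section Corner

variable {A : Type u} [NonUnitalCStarAlgebra A] [PartialOrder A]
  {X : Type v} [NormedAddCommGroup X] [NormedSpace ℂ X] [SMul A X] [CStarModule A X]
  {p : A}

variable (X) in
/-- The subspace `p X` of a Hilbert module. -/
def corner (p : A) : Submodule ℂ X := (actionCLM X p - ContinuousLinearMap.id ℂ X).ker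

theorem mem_corner {x : X} : x ∈ corner X p ↔ p • x = x := by
  simp [corner, sub_eq_zero]

instance [CompleteSpace X] : CompleteSpace (corner X p) :=
  ContinuousLinearMap.completeSpace_ker _

theorem IsMinimalProjection.smul_mem_corner (hp : IsMinimalProjection p) (x : X) :
    p • x ∈ corner X p := by
  rw [mem_corner, ← mul_smul_eq, hp.mul_self]

/-- With `x = p x` and `y = p y` the inner product lies in `p A p = ℂ p`. -/
theorem IsMinimalProjection.inner_eq (hp : IsMinimalProjection p) {x y : X}
    (hx : x ∈ corner X p) (hy : y ∈ corner X p) :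
    inner A x y = hp.functional (inner A x y) • p := by
  rw [← hp.mul_mul_eq]
  conv_lhs => rw [← mem_corner.mp hx, ← mem_corner.mp hy]
  rw [CStarModule.inner_op_smul_right, CStarModule.inner_op_smul_left, hp.star_eq, mul_assoc]

/-- The Hilbert space structure of `p X` for a minimal projection `p`, which the functional of `p`
induces. -/
@[reducible]
def IsMinimalProjection.innerProductSpace [StarOrderedRing A] (hp : IsMinimalProjection p) :
    InnerProductSpace ℂ (corner X p) where
  inner x y := hp.functional (inner A (x : X) (y : X))
  norm_sq_eq_re_inner x := by
    have h1 : (0 : ℂ) ≤ hp.functional (inner A (x : X) (x : X)) :=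
      hp.functional_nonneg CStarModule.inner_self_nonneg
    have h2 : ‖x‖ ^ 2 = ‖hp.functional (inner A (x : X) (x : X))‖ := by
      rw [Submodule.coe_norm, CStarModule.norm_sq_eq A, hp.inner_eq x.2 x.2, norm_smul,
        hp.norm_eq_one, mul_one, map_smul, hp.functional_self, smul_eq_mul, mul_one]
    rw [h2]
    exact (Complex.re_eq_norm.mpr h1).symm
  conj_inner_symm x y := by
    rw [← CStarModule.star_inner, hp.functional_star]
    simp
  add_left x y z := by simp
  smul_left x y c := by simp

end Corner

section SwapStar

variable {A : Type u} [NonUnitalCStarAlgebra A] {X : Type v} [NormedAddCommGroup X]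
  [NormedSpace ℂ X] {Y : Type w} [NormedAddCommGroup Y] [NormedSpace ℂ Y]

/-- The form `(y, x) ↦ B(x, y)⋆`. -/
def swapStar (B : X →L⋆[ℂ] Y →L[ℂ] A) : Y →L⋆[ℂ] X →L[ℂ] A :=
  LinearMap.mkContinuous₂
    (LinearMap.mk₂'ₛₗ (starRingEnd ℂ) (RingHom.id ℂ) (fun y x => star (B x y))
      (fun y y' x => by simp) (fun c y x => by simp) (fun y x x' => by simp)
      (fun c y x => by simp)) ‖B‖ fun y x => by
    have := B.le_opNorm₂ x y
    simp only [LinearMap.mk₂'ₛₗ_apply, norm_star]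
    linarith

theorem swapStar_apply (B : X →L⋆[ℂ] Y →L[ℂ] A) (x : X) (y : Y) :
    swapStar B y x = star (B x y) := rfl

theorem IsASesquilinear.swapStar [SMul A X] [SMul A Y] {B : X →L⋆[ℂ] Y →L[ℂ] A}
    (hB : IsASesquilinear A B) : IsASesquilinear A (swapStar B) := by
  constructor <;> intro a y x <;> simp [swapStar_apply, hB.1, hB.2]

end SwapStar

/-! ### Representation of forms, lower bounds and surjectivity -/

section Forms

variable {A : Type u} [NonUnitalCStarAlgebra A] [PartialOrder A]
  {X : Type v} [NormedAddCommGroup X] [NormedSpace ℂ X] [SMul A X] [CStarModule A X]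
  {Y : Type w} [NormedAddCommGroup Y] [NormedSpace ℂ Y] [SMul A Y] [CStarModule A Y]
  {B : X →L⋆[ℂ] Y →L[ℂ] A} {p : A}

theorem IsASesquilinear.eq_functional_smul (hB : IsASesquilinear A B) (hp : IsMinimalProjection p)
    {x : X} {y : Y} (hx : x ∈ corner X p) (hy : y ∈ corner Y p) :
    B x y = hp.functional (B x y) • p := by
  rw [← hp.mul_mul_eq]
  conv_lhs => rw [← mem_corner.mp hx, ← mem_corner.mp hy]
  rw [hB.1, hB.2, hp.star_eq, mul_assoc]

variable [StarOrderedRing A]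

/-- The Riesz theorem for the forms `B (p x)` with `p` a minimal projection, which reduces to the
one for the Hilbert space `p Y`. -/
theorem IsASesquilinear.exists_inner_eq_of_mem_corner [CompleteSpace Y]
    (hA : IsCompactOperatorAlgebra.{u, z} A)
    (hB : IsASesquilinear A B) (hp : IsMinimalProjection p) {x : X} (hx : x ∈ corner X p) :
    ∃ t : Y, ∀ y : Y, B x y = inner A t y := by
  let _ : InnerProductSpace ℂ (corner Y p) := hp.innerProductSpace
  let l : corner Y p →L[ℂ] ℂ := hp.functional ∘L B x ∘L (corner Y p).subtypeL
  obtain ⟨t, ht⟩ : ∃ t : corner Y p, ∀ y : corner Y p, inner ℂ t y = l y :=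
    ⟨(InnerProductSpace.toDual ℂ (corner Y p)).symm l, fun y =>
      InnerProductSpace.toDual_symm_apply⟩
  have hcorner : ∀ y ∈ corner Y p, B x y = inner A (t : Y) y := fun y hy => by
    rw [hB.eq_functional_smul hp hx hy, hp.inner_eq t.2 hy]
    exact congrArg (· • p) (ht ⟨y, hy⟩).symm
  refine ⟨t, fun y => sub_eq_zero.mp (hA.eq_zero_of_forall_mul_eq_zero fun q hq => ?_)⟩
  have hmul : ∀ b : A, b * (B x y - inner A (t : Y) y) = B x (b • y) - inner A (t : Y) (b • y) :=
    fun b => by rw [mul_sub, hB.1, CStarModule.inner_op_smul_right]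
  -- Let `d = B x y - ⟨t, y⟩`. If some `v = q a p` is nonzero, then `v v⋆` is a nonzero multiple of
  -- `q`, and `v⋆ d = 0` because `v⋆ y` lies in `p Y`. Otherwise `q A p = 0`, and `d = d p` gives `q
  -- d = 0`.
  by_cases h : ∃ a : A, q * a * p ≠ 0
  · obtain ⟨a, ha⟩ := h
    have hvv : q * a * p * star (q * a * p) ≠ 0 := by
      rwa [Ne, CStarRing.mul_star_self_eq_zero_iff]
    have hq' : q * a * p * star (q * a * p) = hq.functional (a * p * star a) • q := by
      rw [← hq.mul_mul_eq]
      simp only [star_mul, hq.star_eq, hp.star_eq, ← mul_assoc]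
      rw [mul_assoc (q * a) p p, hp.mul_self]
    have hmem : star (q * a * p) • y ∈ corner Y p := by
      rw [mem_corner, ← mul_smul_eq, star_mul, hp.star_eq, ← mul_assoc, hp.mul_self]
    have h0 : hq.functional (a * p * star a) • (q * (B x y - inner A (t : Y) y)) = 0 := by
      rw [← smul_mul_assoc, ← hq', mul_assoc, hmul (star (q * a * p)), hcorner _ hmem, sub_self,
        mul_zero]
    refine (smul_eq_zero.mp h0).resolve_left fun h1 => hvv ?_
    rw [hq', h1, zero_smul]
  · push Not at h
    have hd : (B x y - inner A (t : Y) y) * p = B x y - inner A (t : Y) y := by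
      conv_rhs => rw [← mem_corner.mp hx, ← mem_corner.mp t.2]
      rw [hB.2, CStarModule.inner_op_smul_left, hp.star_eq, sub_mul]
    rw [← hd, ← mul_assoc, h]

/-- Cauchy–Schwarz is attained at `y` itself. The resulting isometry makes the representable
functionals closed when `Y` is complete. -/
theorem norm_innerSL_apply (y : Y) : ‖(CStarModule.innerSL y : Y →L[ℂ] A)‖ = ‖y‖ := by
  refine le_antisymm (ContinuousLinearMap.opNorm_le_bound _ (norm_nonneg y) fun x =>
    CStarModule.norm_inner_le Y) ?_
  rcases (norm_nonneg y).eq_or_lt with h | h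
  · rw [← h]; positivity
  · have h1 := (CStarModule.innerSL y : Y →L[ℂ] A).le_opNorm y
    rw [CStarModule.innerSL_apply, ← CStarModule.norm_sq_eq A, pow_two] at h1
    exact le_of_mul_le_mul_right h1 h

/-- A bounded `A`-sesquilinear form over a C⋆-algebra of compact operators is represented by a
bounded operator. -/
theorem IsASesquilinear.exists_eq_inner_apply [CompleteSpace Y]
    (hA : IsCompactOperatorAlgebra.{u, z} A) (hB : IsASesquilinear A B) :
    ∃ T : X →L[ℂ] Y, ∀ x y, B x y = inner A (T x) y := by
  let R : Submodule ℂ X :=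
    { carrier := {x | ∃ t : Y, ∀ y : Y, B x y = inner A t y}
      add_mem' := by
        rintro x x' ⟨t, ht⟩ ⟨t', ht'⟩
        exact ⟨t + t', fun y => by simp [ht, ht']⟩
      zero_mem' := ⟨0, fun y => by simp⟩
      smul_mem' := by
        rintro c x ⟨t, ht⟩
        exact ⟨c • t, fun y => by simp [ht]⟩ }
  have hiso : Isometry (CStarModule.innerSL : Y →L⋆[ℂ] Y →L[ℂ] A) :=
    AddMonoidHomClass.isometry_of_norm _ norm_innerSL_apply
  have hR : (R : Set X) = B ⁻¹' Set.range (CStarModule.innerSL : Y →L⋆[ℂ] Y →L[ℂ] A) := by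
    ext x
    constructor
    · rintro ⟨t, ht⟩
      exact ⟨t, ContinuousLinearMap.ext fun y => (ht y).symm⟩
    · rintro ⟨t, ht⟩
      exact ⟨t, fun y => by rw [← ht, CStarModule.innerSL_apply]⟩
  have hRc : IsClosed (R : Set X) := by
    rw [hR]
    exact hiso.isClosedEmbedding.isClosed_range.preimage B.continuous
  have htop := hA.eq_top_of_forall_smul_mem R hRc fun p x hp =>
    hB.exists_inner_eq_of_mem_corner hA hp (hp.smul_mem_corner x)
  have hall : ∀ x : X, ∃ t : Y, ∀ y : Y, B x y = inner A t y := fun x => by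
    have : x ∈ R := htop ▸ Submodule.mem_top
    exact this
  choose T hT using hall
  let L : X →ₗ[ℂ] Y :=
    { toFun := T
      map_add' := fun x x' => ext_inner_left (A := A) fun y => by simp [← hT]
      map_smul' := fun c x => ext_inner_left (A := A) fun y => by simp [← hT] }
  refine ⟨L.mkContinuous ‖B‖ fun x => ?_, hT⟩
  have : (CStarModule.innerSL (T x) : Y →L[ℂ] A) = B x :=
    ContinuousLinearMap.ext fun y => (hT x y).symm
  change ‖T x‖ ≤ _
  rw [← norm_innerSL_apply (A := A), this]
  exact B.le_opNorm x

/-- The C⋆-identity for `|x|`; it turns the top eigenvalue of `|x|` into `‖x‖`. -/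
theorem norm_absElt (x : X) : ‖absElt A x‖ = ‖x‖ := by
  have h0 : 0 ≤ absElt A x := CFC.sqrt_nonneg _
  have h1 : absElt A x * absElt A x = inner A x x :=
    CFC.sqrt_mul_sqrt_self _ CStarModule.inner_self_nonneg
  have h2 : ‖absElt A x‖ ^ 2 = ‖x‖ ^ 2 := by
    rw [CStarModule.norm_sq_eq A (x := x), ← h1, pow_two, ← CStarRing.norm_star_mul_self,
      (IsSelfAdjoint.of_nonneg h0).star_eq]
  exact (pow_left_inj₀ (norm_nonneg _) (norm_nonneg _) two_ne_zero).mp h2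

/-- A coercivity condition at the pure states yields a lower bound for the norms of the forms
`B x`. -/
theorem le_norm_of_forall_pureStates (hA : IsCompactOperatorAlgebra.{u, z} A)
    {β : X → Y → A} {c k : ℝ} (hc : 0 < c)
    (h : ∀ f ∈ pureStates A, ∀ x : X, ∃ y : Y, ‖y‖ = 1 ∧ k ≤ (f (absElt A y)).re ∧
      c * (f (absElt A x)).re * (f (absElt A y)).re ≤ ‖f (β x y)‖) {x : X} {M : ℝ} (hM0 : 0 ≤ M)
    (hM : ∀ y, ‖y‖ = 1 → ‖β x y‖ ≤ M) : c * k * ‖x‖ ≤ M := by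
  rcases eq_or_ne x 0 with rfl | hx
  · simpa using hM0
  have h0 : 0 ≤ absElt A x := CFC.sqrt_nonneg _
  have hne : absElt A x ≠ 0 := by
    rw [← norm_ne_zero_iff, norm_absElt]
    simpa using hx
  obtain ⟨p, hp, hap⟩ := hA.exists_isMinimalProjection h0 hne
  have hf : hp.functional (absElt A x) = (‖x‖ : ℂ) := hp.functional_eq <| by
    rw [mul_assoc, hap, mul_smul_comm, hp.mul_self, norm_absElt]
  obtain ⟨y, hy1, hky, hxy⟩ := h _ hp.functional_mem_pureStates x
  rw [hf, Complex.ofReal_re] at hxy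
  calc c * k * ‖x‖ = c * ‖x‖ * k := by ring
    _ ≤ c * ‖x‖ * (hp.functional (absElt A y)).re := by gcongr
    _ ≤ ‖hp.functional (β x y)‖ := hxy
    _ ≤ M := (hp.norm_functional_le _).trans (hM y hy1)

/-- An adjointable operator between Hilbert modules over a C⋆-algebra of compact operators is
surjective if it and its adjoint are bounded below. -/
theorem IsCompactOperatorAlgebra.range_eq_top (hA : IsCompactOperatorAlgebra.{u, z} A)
    [CompleteSpace X] [CompleteSpace Y] {T : X →L[ℂ] Y} {S : Y →L[ℂ] X}
    (hTS : ∀ (x : X) (y : Y), inner A (T x) y = inner A x (S y)) {δ : ℝ} (hδ : 0 < δ)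
    (hT : ∀ x, δ * ‖x‖ ≤ ‖T x‖) (hS : ∀ y, S y = 0 → y = 0) :
    (T : X →ₗ[ℂ] Y).range = ⊤ := by
  have hanti : AntilipschitzWith (Real.toNNReal δ⁻¹) T :=
    AddMonoidHomClass.antilipschitz_of_bound T fun x => by
      rw [Real.coe_toNNReal _ (by positivity), ← div_eq_inv_mul, le_div_iff₀ hδ, mul_comm]
      exact hT x
  have hclosed : IsClosed ((T : X →ₗ[ℂ] Y).range : Set Y) := by
    rw [LinearMap.coe_range]
    exact hanti.isClosed_range T.uniformContinuous
  refine hA.eq_top_of_forall_smul_mem _ hclosed fun p y hp => ?_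
  have hSmem : ∀ y ∈ corner Y p, S y ∈ corner X p := fun y hy => by
    rw [mem_corner]
    refine ext_inner_right (A := A) fun x => ?_
    rw [CStarModule.inner_op_smul_right, ← hTS, ← CStarModule.inner_op_smul_right,
      mem_corner.mp hy, hTS]
  let _ : InnerProductSpace ℂ (corner Y p) := hp.innerProductSpace
  let K : Submodule ℂ (corner Y p) := (T : X →ₗ[ℂ] Y).range.comap (corner Y p).subtype
  have hK : IsClosed (K : Set (corner Y p)) := hclosed.preimage continuous_subtype_val
  have : CompleteSpace K := hK.completeSpace_coe
  have hKtop : K = ⊤ := by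
    rw [← Submodule.orthogonal_eq_bot_iff, Submodule.eq_bot_iff]
    rintro ⟨y, hy⟩ hyK
    have hTSy : T (S y) ∈ corner Y p := by
      rw [mem_corner]
      refine ext_inner_right (A := A) fun t => ?_
      have h1 : ∀ b : A, ∀ x : X, T (b • x) = b • T x := fun b x =>
        ext_inner_left (A := A) fun t => by simp [hTS]
      rw [← h1, mem_corner.mp (hSmem y hy)]
    -- `T (S y)` is itself in the range and in the corner, so `y` is orthogonal to it, and `⟨T S y,
    -- y⟩ = ⟨S y, S y⟩`.
    have h1 : hp.functional (inner A (T (S y)) y) = 0 :=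
      (Submodule.mem_orthogonal K _).mp hyK ⟨T (S y), hTSy⟩ ⟨S y, rfl⟩
    rw [hTS] at h1
    have h2 : S y = 0 := by
      rw [← CStarModule.inner_self (A := A), hp.inner_eq (hSmem y hy) (hSmem y hy), h1, zero_smul]
    exact Subtype.ext (hS y h2)
  have : (⟨p • y, hp.smul_mem_corner y⟩ : corner Y p) ∈ K := hKtop ▸ Submodule.mem_top
  exact this

end Forms

/-! ### Failure of the Riesz theorem -/

section Counterexample

/-- The operator factors through `ℂ`, which is locally compact. -/
theorem isCompactOperator_rankOne (H : Type z) [NormedAddCommGroup H] [InnerProductSpace ℂ H]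
    (v w : H) :
    IsCompactOperator (InnerProductSpace.rankOne ℂ v w : H →L[ℂ] H) := by
  have h : IsCompactOperator (innerSL ℂ w : H →L[ℂ] ℂ) :=
    isCompactOperator_of_locallyCompactSpace_dom (innerSL ℂ w : H →L[ℂ] ℂ)
  exact h.clm_comp (ContinuousLinearMap.toSpanSingleton ℂ v)

variable (H : Type z) [NormedAddCommGroup H] [InnerProductSpace ℂ H] [CompleteSpace H]

/-- The C⋆-algebra of the operators on a Hilbert space that are compact with compact adjoint. -/
def compactStarSubalgebra : NonUnitalStarSubalgebra ℂ (H →L[ℂ] H) where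
  carrier := {T : H →L[ℂ] H | IsCompactOperator T ∧ IsCompactOperator (star T : H →L[ℂ] H)}
  add_mem' := by
    rintro S T ⟨h1, h2⟩ ⟨h3, h4⟩
    refine ⟨h1.add h3, ?_⟩
    rw [star_add]
    exact h2.add h4
  zero_mem' := ⟨isCompactOperator_zero, by rw [star_zero]; exact isCompactOperator_zero⟩
  mul_mem' := by
    rintro S T ⟨h1, h2⟩ ⟨h3, h4⟩
    refine ⟨h1.comp_clm T, ?_⟩
    rw [star_mul]
    exact h4.comp_clm (star S)
  smul_mem' := by
    rintro c T ⟨h1, h2⟩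
    refine ⟨h1.smul c, ?_⟩
    rw [star_smul]
    exact h2.smul (star c)
  star_mem' := by
    rintro T ⟨h1, h2⟩
    exact ⟨h2, by rwa [star_star]⟩

instance isClosed_compactStarSubalgebra : IsClosed (compactStarSubalgebra H : Set (H →L[ℂ] H)) := by
  have h : IsClosed {T : H →L[ℂ] H | IsCompactOperator T} := isClosed_setOfPred_isCompactOperator
  exact h.inter (h.preimage continuous_star)

theorem isCompactOperatorAlgebra_compactStarSubalgebra :
    IsCompactOperatorAlgebra.{z, z} (compactStarSubalgebra H) :=
  ⟨H, inferInstance, inferInstance, inferInstance,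
    NonUnitalStarSubalgebraClass.subtype (compactStarSubalgebra H), Subtype.val_injective,
    fun a => a.2.1⟩

/-- The identity map of the algebra of compact operators on an infinite-dimensional Hilbert space
is not of the form `⟨x, ·⟩`. -/
theorem not_isSelfDual_compactStarSubalgebra [PartialOrder (compactStarSubalgebra H)]
    [StarOrderedRing (compactStarSubalgebra H)] (hH : ¬ FiniteDimensional ℂ H) :
    ¬ IsSelfDual (compactStarSubalgebra H) (compactStarSubalgebra H) := by
  intro h
  obtain ⟨x, hx⟩ := h (ContinuousLinearMap.id ℂ _) fun a y => rfl
  have h1 : star (x : H →L[ℂ] H) = 1 := by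
    ext w
    refine _root_.ext_inner_left ℂ fun v => ?_
    rcases eq_or_ne v 0 with rfl | hv
    · simp
    have hmem : InnerProductSpace.rankOne ℂ v v ∈ compactStarSubalgebra H := by
      refine ⟨isCompactOperator_rankOne H v v, ?_⟩
      rw [ContinuousLinearMap.star_eq_adjoint, InnerProductSpace.adjoint_rankOne]
      exact isCompactOperator_rankOne H v v
    -- The assumption reads `y = y x⋆`; a rank-one `y` along `v` compares `⟨v, w⟩` with `⟨v, x⋆ w⟩`.
    have h2 := congrArg (fun T : compactStarSubalgebra H => (T : H →L[ℂ] H) w) (hx ⟨_, hmem⟩)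
    exact (smul_left_injective ℂ hv h2).symm
  apply hH
  have h2 := x.2.2
  rw [h1] at h2
  exact FiniteDimensional.of_isCompactOperator_id h2

end Counterexample

/-! ### Assembly of the theorem -/

/-- The Lax–Milgram theorem over C⋆-algebras of compact operators. -/
theorem laxMilgram (A : Type u) [NonUnitalCStarAlgebra A] [PartialOrder A]
    [StarOrderedRing A]
    (X : Type v) [NormedAddCommGroup X] [NormedSpace ℂ X] [SMul A X] [CStarModule A X]
    [CompleteSpace X]
    (Y : Type w) [NormedAddCommGroup Y] [NormedSpace ℂ Y] [SMul A Y] [CStarModule A Y]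
    [CompleteSpace Y]
    (B : X →L⋆[ℂ] Y →L[ℂ] A) (hA : IsCompactOperatorAlgebra.{u, z} A) (hB : IsASesquilinear A B)
    (hX : ∃ c > (0 : ℝ), ∃ k > (0 : ℝ), ∀ f ∈ pureStates A, ∀ x : X, ∃ y : Y,
      ‖y‖ = 1 ∧ k ≤ (f (absElt A y)).re ∧
      c * (f (absElt A x)).re * (f (absElt A y)).re ≤ ‖f (B x y)‖)
    (hY : ∃ c > (0 : ℝ), ∃ k > (0 : ℝ), ∀ f ∈ pureStates A, ∀ y : Y, ∃ x : X,
      ‖x‖ = 1 ∧ k ≤ (f (absElt A x)).re ∧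
      c * (f (absElt A x)).re * (f (absElt A y)).re ≤ ‖f (B x y)‖) :
    ∃ T : X ≃L[ℂ] Y, IsALinear A (T : X →L[ℂ] Y) ∧ IsAdjointable A (T : X →L[ℂ] Y) ∧
      ∀ (x : X) (y : Y), B x y = inner A (T x) y := by
  obtain ⟨T, hT⟩ := hB.exists_eq_inner_apply hA
  obtain ⟨S, hS⟩ := hB.swapStar.exists_eq_inner_apply hA
  have hTS : ∀ (x : X) (y : Y), inner A (T x) y = inner A x (S y) := fun x y => by
    rw [← hT, ← CStarModule.star_inner, ← hS, swapStar_apply, star_star]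
  obtain ⟨c, hc, k, hk, hck⟩ := hX
  obtain ⟨c', hc', k', hk', hck'⟩ := hY
  have hTb : ∀ x, c * k * ‖x‖ ≤ ‖T x‖ := fun x =>
    le_norm_of_forall_pureStates hA hc hck (norm_nonneg _) fun y hy => by
      rw [hT]
      simpa [hy] using CStarModule.norm_inner_le (A := A) Y (x := T x) (y := y)
  have hSb : ∀ y, c' * k' * ‖y‖ ≤ ‖S y‖ := fun y =>
    le_norm_of_forall_pureStates (β := fun y x => B x y) hA hc'
      (fun f hf y => by
        obtain ⟨x, h1, h2, h3⟩ := hck' f hf y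
        exact ⟨x, h1, h2, by rwa [mul_right_comm]⟩) (norm_nonneg _) fun x hx => by
      rw [hT, hTS]
      simpa [hx] using CStarModule.norm_inner_le (A := A) X (x := x) (y := S y)
  have hker : ∀ y, S y = 0 → y = 0 := fun y hy => by
    have h1 := hSb y
    rw [hy, norm_zero] at h1
    have h2 : 0 < c' * k' := by positivity
    exact norm_le_zero_iff.mp (by nlinarith [norm_nonneg y])
  have hinj : (T : X →ₗ[ℂ] Y).ker = ⊥ := by
    rw [LinearMap.ker_eq_bot']
    intro x hx
    have h1 := hTb x
    have h3 : T x = 0 := hx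
    rw [h3, norm_zero] at h1
    have h2 : 0 < c * k := by positivity
    exact norm_le_zero_iff.mp (by nlinarith [norm_nonneg x])
  refine ⟨ContinuousLinearEquiv.ofBijective T hinj
    (hA.range_eq_top hTS (mul_pos hc hk) hTb hker), fun a x => ?_, ⟨S, hTS⟩, hT⟩
  -- `A`-linearity of `T` follows from the existence of an adjoint.
  refine ext_inner_left (A := A) fun y => ?_
  change inner A (T (a • x)) y = inner A (a • T x) y
  rw [hTS, CStarModule.inner_op_smul_left, CStarModule.inner_op_smul_left, hTS]

end HilbertCStar

end

theorem theorem3p1 :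
    (∀ (A : Type u) [NonUnitalCStarAlgebra A] [PartialOrder A] [StarOrderedRing A]
      (X : Type v) [NormedAddCommGroup X] [NormedSpace ℂ X] [SMul A X] [CStarModule A X]
      [CompleteSpace X]
      (Y : Type w) [NormedAddCommGroup Y] [NormedSpace ℂ Y] [SMul A Y] [CStarModule A Y]
      [CompleteSpace Y]
      (B : X →L⋆[ℂ] Y →L[ℂ] A),
      HilbertCStar.IsCompactOperatorAlgebra.{u, z} A →
      HilbertCStar.IsASesquilinear A B →
      (∃ c > (0 : ℝ), ∃ k > (0 : ℝ), ∀ f ∈ HilbertCStar.pureStates A, ∀ x : X, ∃ y : Y,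
        ‖y‖ = 1 ∧ k ≤ (f (HilbertCStar.absElt A y)).re ∧
        c * (f (HilbertCStar.absElt A x)).re * (f (HilbertCStar.absElt A y)).re ≤ ‖f (B x y)‖) →
      (∃ c > (0 : ℝ), ∃ k > (0 : ℝ), ∀ f ∈ HilbertCStar.pureStates A, ∀ y : Y, ∃ x : X,
        ‖x‖ = 1 ∧ k ≤ (f (HilbertCStar.absElt A x)).re ∧
        c * (f (HilbertCStar.absElt A x)).re * (f (HilbertCStar.absElt A y)).re ≤ ‖f (B x y)‖) →
      ∃ T : X ≃L[ℂ] Y,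
        HilbertCStar.IsALinear A (T : X →L[ℂ] Y) ∧
        HilbertCStar.IsAdjointable A (T : X →L[ℂ] Y) ∧
        ∀ (x : X) (y : Y), B x y = inner A (T x) y) ∧
    (∃ (A : Type) (_ : NonUnitalCStarAlgebra A) (_ : PartialOrder A) (_ : StarOrderedRing A)
      (X : Type) (_ : NormedAddCommGroup X) (_ : NormedSpace ℂ X) (_ : SMul A X)
      (_ : CStarModule A X) (_ : CompleteSpace X),
      HilbertCStar.IsCompactOperatorAlgebra.{0, 0} A ∧ ¬ HilbertCStar.IsSelfDual A X) := by
  refine ⟨fun A _ _ _ X _ _ _ _ _ Y _ _ _ _ _ B hA hB hX hY =>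
    HilbertCStar.laxMilgram A X Y B hA hB hX hY, ?_⟩
  let A := HilbertCStar.compactStarSubalgebra (lp (fun _ : ℕ => ℂ) 2)
  let _ : PartialOrder A := CStarAlgebra.spectralOrder A
  have _ : StarOrderedRing A := CStarAlgebra.spectralOrderedRing A
  refine ⟨A, inferInstance, inferInstance, inferInstance, A, inferInstance, inferInstance,
    inferInstance, inferInstance, inferInstance,
    HilbertCStar.isCompactOperatorAlgebra_compactStarSubalgebra _,
    HilbertCStar.not_isSelfDual_compactStarSubalgebra _ fun hfin => ?_⟩
  -- The standard basis of `ℓ²` is an infinite linearly independent family.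
  let b : HilbertBasis ℕ ℂ (lp (fun _ : ℕ => ℂ) 2) := ⟨LinearIsometryEquiv.refl ℂ _⟩
  exact not_finite_iff_infinite.mpr (inferInstance : Infinite ℕ)
    b.orthonormal.linearIndependent.finite
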